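/- Let $d\ge 2$ be an integer and $C$ a real number. A convex body in $\mathbb R^d$ is a nonempty compact convex set; a set $B\subset\mathbb R^d$ is $C$-fat if for some $r>0$ it contains a ball of radius $r$ and is contained in a ball of radius $Cr$. There is a constant $A=A(d,C)>0$, depending only on $d$ and $C$, such that the following holds. Let $n\neq 1$ be a nonnegative integer, let $\mathcal S=(S_1,\dots,S_n)$ be a family of boundaries of $C$-fat convex bodies in $\mathbb R^d$, and let $G(\mathcal S)$ be its intersection graph: its vertices are the $n$ members of the family, and two different members are adjacent if and only if they have a point in common. Then $G(\mathcal S)$ has a balanced separator, that is, a vertex set $\mathcal X$ such that each connected component of $G(\mathcal S)\setminus\mathcal X$ has at most $\tfrac23 n$ vertices, of size $$|\mathcal X|\le A\left(\sum_{i=1}^n \deg(S_i)^{\frac1{d-1}}\right)^{1-\frac1d},$$ where $\deg$ is the degree in $G(\mathcal S)$. In particular, if $G(\mathcal S)$ has $m$ edges, then it has a balanced separator of size at most $A\,m^{1/d}n^{1-2/d}$. -/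

import Mathlib

/-- A set `B` is `C`-fat if, for some radius `r > 0`, it contains a ball of radius `r` and is
contained in a ball of radius `C * r`. -/
def IsFat {d : ℕ} (C : ℝ) (B : Set (EuclideanSpace ℝ (Fin d))) : Prop :=
  ∃ r : ℝ, 0 < r ∧ (∃ x, Metric.closedBall x r ⊆ B) ∧ ∃ y, B ⊆ Metric.closedBall y (C * r)

/-- The intersection graph of a family of sets: the vertices are the members of the family, and
two distinct members are adjacent when they have a common point. -/
def intersectionGraph {ι α : Type*} (S : ι → Set α) : SimpleGraph ι where
  Adj i j := i ≠ j ∧ (S i ∩ S j).Nonempty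
  symm := ⟨fun _ _ h => ⟨h.1.symm, by rw [Set.inter_comm]; exact h.2⟩⟩
  loopless := ⟨fun _ h => h.1 rfl⟩

noncomputable instance {ι α : Type*} (S : ι → Set α) :
    DecidableRel (intersectionGraph S).Adj :=
  Classical.decRel _

/-- A vertex set `X` is a balanced separator of `G` if each connected component of the graph
obtained from `G` by deleting `X` has at most `2/3` of the vertices of `G`. -/
def IsBalancedSeparator {V : Type*} [Fintype V] (G : SimpleGraph V) (X : Finset V) : Prop :=
  ∀ c : (G.induce {v : V | v ∉ X}).ConnectedComponent,
    (c.supp.ncard : ℝ) ≤ 2 / 3 * (Fintype.card V : ℝ)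

/-!
Write `T = (∑ deg ^ (1 / (d - 1))) ^ (1 - 1 / d)`. If there is no balanced separator of size
`O(T)`, then deleting any `O(T)` vertices leaves a unique component with more than two thirds of the
vertices, and these large components are compatible with each other (`IsHaven`). The key
statement is `FatFamily.exists_cut`: around every ball `B(x, r)` one can delete `O(T)` vertices so
that the large component lies inside `B(x, 2r)` or avoids `B(x, r)`. Since `B(x, 2r)` is
covered by boundedly many balls of radius `r / 2`, a large component inside `B(x, 2r)` forces
one inside a ball around some other point with half the radius, and descending to arbitrarily
small balls is absurd.

For the cut, one takes a random sphere around `x` with radius in `[r, 2r]`. Let `w` be the radius of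
a body divided by `r` and truncated at `1`; up to constants, `w` bounds the probability that the
sphere meets a fixed enlargement of the body. The difficulty is that the boundaries of many
nested bodies may all cross the sphere although each of them has small degree. Call a
vertex heavy if `deg > T * w ^ (d - 1)` and light otherwise.

* Heavy vertices crossing the sphere are deleted. As `w < (deg / T) ^ (1 / (d - 1))`, their expected
  number is at most a constant times `∑ (deg / T) ^ (1 / (d - 1)) = T`.
* A light vertex has degree at most `T`, so its closed neighbourhood can be deleted, and the large
  component then lies inside or outside its body (`FatFamily.haven_inside_or_outside`). One
  neighbourhood, that of a body of smallest volume, disposes of all bodies of the first kind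
  (`FatFamily.exists_cut_inner`).
* Among the light vertices of the second kind, a greedy selection by decreasing volume gives
  disjoint bodies such that every other light body meets a selected one which is at least as
  large. Whenever the sphere comes near a selected body, its closed neighbourhood is deleted.
  This also cuts off everything nested inside it. The expected cost is of order
  `∑ deg * w ≤ T * ∑ w ^ d`, which is `O(T)` by comparing volumes
  (`FatFamily.sum_min_radius_pow_le`).

After these deletions no boundary in the large component meets the sphere, so the component, whose
boundaries have a connected union, lies on one side of it. The bound in terms of the number of
edges follows by the power mean inequality.
-/

open MeasureTheory

/-! ### Havens -/

/-- A haven of order `t` in `G`: to every vertex set `X` with at most `t` elements it assigns a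
connected component `β X` of `G - X` containing more than two thirds of the vertices of `G`.
Connectedness is expressed by chains of adjacent vertices inside `β X`, and maximality by
`closed`. The values of `β` at larger sets are arbitrary. -/
structure IsHaven {V : Type*} [Fintype V] (G : SimpleGraph V) (t : ℝ)
    (β : Finset V → Set V) : Prop where
  avoid : ∀ X : Finset V, (X.card : ℝ) ≤ t → ∀ v ∈ β X, v ∉ X
  chain : ∀ X : Finset V, (X.card : ℝ) ≤ t → ∀ u ∈ β X, ∀ v ∈ β X,
    Relation.ReflTransGen (fun a b => G.Adj a b ∧ a ∈ β X ∧ b ∈ β X) u v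
  closed : ∀ X : Finset V, (X.card : ℝ) ≤ t → ∀ u ∈ β X, ∀ v, G.Adj u v → v ∉ X → v ∈ β X
  large : ∀ X : Finset V, (X.card : ℝ) ≤ t → 2 / 3 * (Fintype.card V : ℝ) < (β X).ncard

namespace IsHaven

variable {V : Type*} [Fintype V] {G : SimpleGraph V} {t : ℝ} {β : Finset V → Set V}

theorem nonempty (h : IsHaven G t β) {X : Finset V} (hX : (X.card : ℝ) ≤ t) :
    (β X).Nonempty := by
  have h1 := h.large X hX
  have h2 : (0 : ℝ) < (β X).ncard := lt_of_le_of_lt (by positivity) h1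
  exact Set.nonempty_of_ncard_ne_zero (by exact_mod_cast h2.ne')

theorem antitone (h : IsHaven G t β) {X Y : Finset V} (hXY : X ⊆ Y)
    (hY : (Y.card : ℝ) ≤ t) : β Y ⊆ β X := by
  have hX : (X.card : ℝ) ≤ t :=
    le_trans (by exact_mod_cast Finset.card_le_card hXY) hY
  -- Two sets with more than two thirds of the vertices each have a common vertex.
  have hmeet : (β Y ∩ β X).Nonempty := by
    by_contra hne
    have hdis : Disjoint (β Y) (β X) :=
      Set.disjoint_iff_inter_eq_empty.2 (Set.not_nonempty_iff_eq_empty.1 hne)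
    have h1 := Set.ncard_union_eq hdis
    have h2 : (β Y ∪ β X).ncard ≤ Fintype.card V := by
      rw [← Nat.card_eq_fintype_card]
      exact Set.ncard_le_card _
    have h3 := h.large X hX
    have h4 := h.large Y hY
    rw [h1] at h2
    have h5 : ((β Y).ncard : ℝ) + (β X).ncard ≤ Fintype.card V := by exact_mod_cast h2
    have h6 : (0 : ℝ) ≤ Fintype.card V := by positivity
    linarith
  obtain ⟨w, hwY, hwX⟩ := hmeet
  intro v hv
  have hc := h.chain Y hY w hwY v hv
  induction hc with
  | refl => exact hwX
  | tail _ hbc ih =>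
    exact h.closed X hX _ (ih hbc.2.1) _ hbc.1 fun hmem => h.avoid Y hY _ hbc.2.2 (hXY hmem)

/-- The vertices of `β X` are not isolated, provided there are at least two vertices in all. -/
theorem exists_adj (h : IsHaven G t β) (hn : 2 ≤ Fintype.card V) {X : Finset V}
    (hX : (X.card : ℝ) ≤ t) {v : V} (hv : v ∈ β X) : ∃ u, G.Adj v u := by
  have h1 := h.large X hX
  have h2 : (2 : ℝ) ≤ Fintype.card V := by exact_mod_cast hn
  have h3 : (1 : ℝ) < (β X).ncard := by linarith
  have h4 : 1 < (β X).ncard := by exact_mod_cast h3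
  obtain ⟨u, hu, huv⟩ := Set.exists_ne_of_one_lt_ncard h4 v
  rcases Relation.ReflTransGen.cases_head (h.chain X hX v hv u hu) with h5 | ⟨w, hw, _⟩
  · exact absurd h5.symm huv
  · exact ⟨w, hw.1⟩

end IsHaven

theorem exists_isHaven {V : Type*} [Fintype V] (G : SimpleGraph V) (t : ℝ)
    (H : ∀ X : Finset V, (X.card : ℝ) ≤ t → ¬ IsBalancedSeparator G X) :
    ∃ β : Finset V → Set V, IsHaven G t β := by
  have key : ∀ X : Finset V, ∃ B : Set V, (X.card : ℝ) ≤ t →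
      (∀ v ∈ B, v ∉ X) ∧
      (∀ u ∈ B, ∀ v ∈ B, Relation.ReflTransGen (fun a b => G.Adj a b ∧ a ∈ B ∧ b ∈ B) u v) ∧
      (∀ u ∈ B, ∀ v, G.Adj u v → v ∉ X → v ∈ B) ∧
      2 / 3 * (Fintype.card V : ℝ) < B.ncard := by
    intro X
    by_cases hX : (X.card : ℝ) ≤ t
    · have h1 := H X hX
      unfold IsBalancedSeparator at h1
      push Not at h1
      obtain ⟨c, hc⟩ := h1
      refine ⟨Subtype.val '' c.supp, fun _ => ⟨?_, ?_, ?_, ?_⟩⟩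
      · rintro v ⟨w, _, rfl⟩
        exact w.2
      · rintro _ ⟨u, hu, rfl⟩ _ ⟨v, hv, rfl⟩
        have hr : (G.induce {v : V | v ∉ X}).Reachable u v :=
          c.reachable_of_mem_supp hu hv
        rw [SimpleGraph.reachable_iff_reflTransGen] at hr
        have : Relation.ReflTransGen
            (fun a b => G.Adj a b ∧ a ∈ Subtype.val '' c.supp ∧ b ∈ Subtype.val '' c.supp)
            (u : V) (v : V) ∧ v ∈ c.supp := by
          clear hv
          induction hr with
          | refl => exact ⟨Relation.ReflTransGen.refl, hu⟩
          | tail _ hbc ih =>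
            have hm := c.mem_supp_of_adj_mem_supp ih.2 hbc
            exact ⟨ih.1.tail ⟨hbc, ⟨_, ih.2, rfl⟩, ⟨_, hm, rfl⟩⟩, hm⟩
        exact this.1
      · rintro _ ⟨u, hu, rfl⟩ v huv hv
        exact ⟨⟨v, hv⟩, c.mem_supp_of_adj_mem_supp hu (by simpa using huv), rfl⟩
      · rwa [Set.ncard_image_of_injective _ Subtype.val_injective]
    · exact ⟨∅, fun h => absurd h hX⟩
  choose β hβ using key
  exact ⟨β, fun X hX => (hβ X hX).1, fun X hX => (hβ X hX).2.1, fun X hX => (hβ X hX).2.2.1,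
    fun X hX => (hβ X hX).2.2.2⟩

/-! ### Convex bodies and their boundaries -/

theorem IsPreconnected.subset_interior_or_subset_compl {E : Type*} [TopologicalSpace E]
    {U K : Set E} (hU : IsPreconnected U) (hK : IsClosed K) (h : Disjoint U (frontier K)) :
    U ⊆ interior K ∨ U ⊆ Kᶜ := by
  refine hU.subset_or_subset isOpen_interior hK.isOpen_compl ?_ ?_
  · exact Set.disjoint_compl_right_iff_subset.2 interior_subset
  · intro x hx
    by_cases hxK : x ∈ K
    · refine Or.inl (by_contra fun hi => Set.disjoint_left.1 h hx ?_)
      rw [hK.frontier_eq]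
      exact ⟨hxK, hi⟩
    · exact Or.inr hxK

section Normed

variable {E : Type*} [NormedAddCommGroup E] [NormedSpace ℝ E]

/-- From a point of a bounded closed set, every ray reaches the boundary. -/
theorem exists_nonneg_add_smul_mem_frontier {K : Set E} (hc : IsClosed K)
    (hb : Bornology.IsBounded K) {x : E} (hx : x ∈ K) {e : E} (he : e ≠ 0) :
    ∃ t : ℝ, 0 ≤ t ∧ x + t • e ∈ frontier K := by
  by_contra hcon
  push Not at hcon
  have hconn : IsPreconnected ((fun t : ℝ => x + t • e) '' Set.Ici 0) :=
    isPreconnected_Ici.image _ (by fun_prop)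
  have hdis : Disjoint ((fun t : ℝ => x + t • e) '' Set.Ici 0) (frontier K) := by
    rw [Set.disjoint_left]
    rintro _ ⟨t, ht, rfl⟩
    exact hcon t ht
  have hx0 : x ∈ (fun t : ℝ => x + t • e) '' Set.Ici 0 := ⟨0, by simp, by simp⟩
  rcases hconn.subset_interior_or_subset_compl hc hdis with h | h
  · obtain ⟨ρ, hρ⟩ := hb.subset_closedBall x
    have hne : 0 < ‖e‖ := norm_pos_iff.2 he
    have hρ0 : 0 ≤ ρ := dist_nonneg.trans (hρ hx)
    have ht : (0 : ℝ) ≤ (ρ + 1) / ‖e‖ := by positivity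
    have hm := hρ (interior_subset (h ⟨(ρ + 1) / ‖e‖, ht, rfl⟩))
    simp only [Metric.mem_closedBall, dist_self_add_left, norm_smul, Real.norm_eq_abs,
      abs_of_nonneg ht] at hm
    rw [div_mul_cancel₀ _ hne.ne'] at hm
    linarith
  · exact h hx0 hx

theorem subset_of_frontier_subset [Nontrivial E] {K O : Set E} (hc : IsClosed K)
    (hb : Bornology.IsBounded K) (hO : Convex ℝ O) (h : frontier K ⊆ O) : K ⊆ O := by
  intro x hx
  obtain ⟨e, he⟩ := exists_ne (0 : E)
  obtain ⟨s, hs, hsK⟩ := exists_nonneg_add_smul_mem_frontier hc hb hx he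
  obtain ⟨t, ht, htK⟩ := exists_nonneg_add_smul_mem_frontier hc hb hx (neg_ne_zero.2 he)
  rcases hs.eq_or_lt with rfl | hs0
  · simpa using h hsK
  -- `x` is a convex combination of the boundary points `x + s • e` and `x - t • e`.
  have hst : 0 < s + t := by linarith
  have hmem := hO (h hsK) (h htK) (a := t / (s + t)) (b := s / (s + t)) (by positivity)
    (by positivity) (by field_simp; ring)
  convert hmem using 1
  have h1 : t / (s + t) + s / (s + t) = 1 := by field_simp; ring
  have h2 : (t / (s + t)) * s - (s / (s + t)) * t = 0 := by ring
  have : (t / (s + t)) • (x + s • e) + (s / (s + t)) • (x + t • -e)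
      = (t / (s + t) + s / (s + t)) • x + ((t / (s + t)) * s - (s / (s + t)) * t) • e := by
    module
  rw [this, h1, h2]
  simp

theorem isConnected_frontier_of_convex [FiniteDimensional ℝ E] (hE : 1 < Module.rank ℝ E)
    {K : Set E} (hK : Convex ℝ K) (hne : (interior K).Nonempty) (hb : Bornology.IsBounded K) :
    IsConnected (frontier K) := by
  obtain ⟨h, -, -, hf⟩ := exists_homeomorph_image_interior_closure_frontier_eq_unitBall hK hne hb
  have h1 : IsConnected (h '' frontier K) := by
    rw [hf]
    exact isConnected_sphere hE 0 zero_le_one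
  have h2 := h1.image h.symm h.symm.continuous.continuousOn
  rwa [← Set.image_comp, h.symm_comp_self, Set.image_id] at h2

/-- Two convex bodies with disjoint boundaries are disjoint or nested. -/
theorem subset_interior_or_of_disjoint_frontier [Nontrivial E] {K L : Set E}
    (hL : Convex ℝ L) (hcK : IsCompact K) (hcL : IsCompact L)
    (hfK : IsConnected (frontier K))
    (hdis : Disjoint (frontier K) (frontier L)) (hne : (K ∩ L).Nonempty) :
    K ⊆ interior L ∨ L ⊆ interior K := by
  rcases hfK.isPreconnected.subset_interior_or_subset_compl hcL.isClosed hdis with h | h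
  · exact Or.inl (subset_of_frontier_subset hcK.isClosed hcK.isBounded hL.interior h)
  · have h1 : Disjoint L (frontier K) := (Set.disjoint_left.2 fun x hx => h hx).symm
    rcases hL.isPreconnected.subset_interior_or_subset_compl hcK.isClosed h1 with h2 | h2
    · exact Or.inr h2
    · obtain ⟨x, hxK, hxL⟩ := hne
      exact absurd hxK (h2 hxL)

/-- A body `K` containing a ball of radius `R` and contained in the concentric ball of radius
`D * R` contains balls of all smaller radii near each of its points, by homothety. -/
theorem exists_closedBall_subset_near {K : Set E} (hK : Convex ℝ K) {a p : E} {R D s : ℝ}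
    (hin : Metric.closedBall a R ⊆ K) (hout : K ⊆ Metric.closedBall a (D * R)) (hp : p ∈ K)
    (hs : 0 < s) (hsR : s ≤ R) :
    ∃ z, Metric.closedBall z s ⊆ K ∧ dist z p ≤ D * s := by
  have hR : 0 < R := hs.trans_le hsR
  have h1 : s / R ≤ 1 := (div_le_one hR).2 hsR
  have h0 : 0 ≤ s / R := by positivity
  refine ⟨p + (s / R) • (a - p), ?_, ?_⟩
  · intro y hy
    have hy' : p + (R / s) • (y - p) ∈ K := by
      apply hin
      have : p + (R / s) • (y - p) - a = (R / s) • (y - (p + (s / R) • (a - p))) := by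
        have h2 : (R / s) * (s / R) = 1 := by field_simp
        have : (R / s) • (y - (p + (s / R) • (a - p)))
            = (R / s) • (y - p) - ((R / s) * (s / R)) • (a - p) := by module
        rw [this, h2]
        module
      rw [Metric.mem_closedBall, dist_eq_norm, this, norm_smul, Real.norm_eq_abs,
        abs_of_pos (by positivity), ← dist_eq_norm]
      calc R / s * dist y (p + (s / R) • (a - p)) ≤ R / s * s := by
            gcongr
            exact hy
        _ = R := by field_simp
    have h3 := hK.add_smul_sub_mem hp hy' ⟨h0, h1⟩
    have h4 : (s / R) * (R / s) = 1 := by field_simp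
    have h5 : p + (s / R) • (p + (R / s) • (y - p) - p) = y := by
      have : p + (s / R) • (p + (R / s) • (y - p) - p) = p + ((s / R) * (R / s)) • (y - p) := by
        module
      rw [this, h4]
      module
    rwa [h5] at h3
  · have h6 : dist p a ≤ D * R := hout hp
    rw [dist_self_add_left, norm_smul, Real.norm_eq_abs, abs_of_nonneg h0, ← dist_eq_norm,
      dist_comm]
    calc s / R * dist p a ≤ s / R * (D * R) := by gcongr
      _ = D * s := by field_simp

theorem measureReal_lt_of_subset_interior [Nontrivial E] [FiniteDimensional ℝ E]
    [MeasurableSpace E] [BorelSpace E] (μ : Measure E) [μ.IsAddHaarMeasure] {K L : Set E}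
    (hK : IsCompact K) (hL : IsCompact L) (hne : K.Nonempty) (h : K ⊆ interior L) :
    μ.real K < μ.real L := by
  have hdiff : (interior L \ K).Nonempty := by
    by_contra hcon
    have heq : K = interior L :=
      h.antisymm (Set.sdiff_eq_empty.1 (Set.not_nonempty_iff_eq_empty.1 hcon))
    have hclopen : IsClopen K := ⟨hK.isClosed, heq ▸ isOpen_interior⟩
    have huniv : K = Set.univ := hclopen.eq_univ hne
    have : CompactSpace E := ⟨huniv ▸ hK⟩
    exact noncompact_univ E isCompact_univ
  have hpos : 0 < μ (interior L \ K) :=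
    (isOpen_interior.sdiff hK.isClosed).measure_pos μ hdiff
  have hfin : μ (interior L \ K) ≠ ⊤ :=
    ((measure_mono (Set.sdiff_subset.trans interior_subset)).trans_lt hL.measure_lt_top).ne
  have h1 : μ.real (K ∪ interior L \ K) = μ.real K + μ.real (interior L \ K) :=
    measureReal_union Set.disjoint_sdiff_right
      (isOpen_interior.measurableSet.diff hK.measurableSet) hK.measure_lt_top.ne hfin
  have h2 : μ.real (K ∪ interior L \ K) ≤ μ.real L :=
    measureReal_mono (Set.union_subset (h.trans interior_subset)
      (Set.sdiff_subset.trans interior_subset)) hL.measure_lt_top.ne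
  have h3 : 0 < μ.real (interior L \ K) := ENNReal.toReal_pos hpos.ne' hfin
  linarith

end Normed

/-- Disjoint balls inside a ball: the sum of the `d`-th powers of the radii is at most the
`d`-th power of the radius of the large ball. -/
theorem sum_radius_pow_le {d : ℕ} {ι : Type*} (s : Finset ι)
    (z : ι → EuclideanSpace ℝ (Fin d)) (ρ : ι → ℝ) (hρ : ∀ i ∈ s, 0 ≤ ρ i)
    (x : EuclideanSpace ℝ (Fin d)) {M : ℝ} (hM : 0 ≤ M)
    (hdis : (s : Set ι).PairwiseDisjoint fun i => Metric.closedBall (z i) (ρ i))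
    (hsub : ∀ i ∈ s, Metric.closedBall (z i) (ρ i) ⊆ Metric.closedBall x M) :
    ∑ i ∈ s, ρ i ^ d ≤ M ^ d := by
  set μ : Measure (EuclideanSpace ℝ (Fin d)) := volume
  have hball : ∀ (y : EuclideanSpace ℝ (Fin d)) {r : ℝ}, 0 ≤ r →
      μ.real (Metric.closedBall y r) = r ^ d * μ.real (Metric.closedBall 0 1) := by
    intro y r hr
    rw [Measure.addHaar_real_closedBall' μ y hr, finrank_euclideanSpace_fin]
  have hunit : 0 < μ.real (Metric.closedBall (0 : EuclideanSpace ℝ (Fin d)) 1) :=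
    ENNReal.toReal_pos (Metric.measure_closedBall_pos μ _ one_pos).ne'
      measure_closedBall_lt_top.ne
  have h1 : μ.real (⋃ i ∈ s, Metric.closedBall (z i) (ρ i))
      = ∑ i ∈ s, μ.real (Metric.closedBall (z i) (ρ i)) :=
    measureReal_biUnion_finset hdis (fun i _ => measurableSet_closedBall)
      fun i _ => measure_closedBall_lt_top.ne
  have h2 : μ.real (⋃ i ∈ s, Metric.closedBall (z i) (ρ i)) ≤ μ.real (Metric.closedBall x M) :=
    measureReal_mono (Set.iUnion₂_subset hsub) measure_closedBall_lt_top.ne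
  rw [h1, hball x hM, Finset.sum_congr rfl fun i hi => hball (z i) (hρ i hi),
    ← Finset.sum_mul] at h2
  exact le_of_mul_le_mul_right h2 hunit

/-- Averaging over `t ∈ [r, 2r]`: there is a `t` for which the total weight of the intervals
`[c i - ℓ i, c i + ℓ i]` containing `t` is at most its mean. -/
theorem exists_sum_filter_abs_sub_le {ι : Type*} (s : Finset ι) (c ℓ q : ι → ℝ)
    (hq : ∀ i ∈ s, 0 ≤ q i) (hℓ : ∀ i ∈ s, 0 ≤ ℓ i) {r : ℝ} (hr : 0 < r) :
    ∃ t ∈ Set.Icc r (2 * r),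
      ∑ i ∈ s with |t - c i| ≤ ℓ i, q i ≤ ∑ i ∈ s, q i * (min r (2 * ℓ i) / r) := by
  classical
  set f : ℝ → ℝ := fun t => ∑ i ∈ s, (Metric.closedBall (c i) (ℓ i)).indicator (fun _ => q i) t
  have hI : ∀ i ∈ s, IntegrableOn ((Metric.closedBall (c i) (ℓ i)).indicator (fun _ => q i))
      (Set.Icc r (2 * r)) := fun i _ =>
    (integrableOn_const (by simp)).indicator measurableSet_closedBall
  have hf : IntegrableOn f (Set.Icc r (2 * r)) := integrable_finsetSum s hI
  have hvol : volume (Set.Icc r (2 * r)) = ENNReal.ofReal r := by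
    rw [Real.volume_Icc]; congr 1; ring
  obtain ⟨t, ht, hle⟩ := exists_le_setAverage (μ := volume) (s := Set.Icc r (2 * r))
    (by simp [hvol, hr]) (by simp [hvol]) hf
  refine ⟨t, ht, ?_⟩
  have h1 : f t = ∑ i ∈ s with |t - c i| ≤ ℓ i, q i := by
    rw [Finset.sum_filter]
    refine Finset.sum_congr rfl fun i _ => ?_
    simp [Set.indicator_apply, Real.dist_eq]
  rw [← h1]
  refine hle.trans ?_
  rw [setAverage_eq, measureReal_def, hvol, ENNReal.toReal_ofReal hr.le,
    integral_finsetSum s hI, smul_eq_mul, Finset.mul_sum]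
  refine Finset.sum_le_sum fun i hi => ?_
  rw [setIntegral_indicator measurableSet_closedBall, setIntegral_const, smul_eq_mul]
  have h2 : volume.real (Set.Icc r (2 * r) ∩ Metric.closedBall (c i) (ℓ i))
      ≤ min r (2 * ℓ i) := by
    refine le_min ?_ ?_
    · refine (measureReal_mono Set.inter_subset_left (by simp [hvol])).trans ?_
      rw [measureReal_def, hvol, ENNReal.toReal_ofReal hr.le]
    · refine (measureReal_mono Set.inter_subset_right measure_closedBall_lt_top.ne).trans ?_
      rw [measureReal_def, Real.volume_closedBall, ENNReal.toReal_ofReal]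
      linarith [hℓ i hi]
  have h3 := mul_le_mul_of_nonneg_right h2 (hq i hi)
  calc _ ≤ r⁻¹ * (min r (2 * ℓ i) * q i) := by gcongr
    _ = _ := by ring

/-- Greedy selection by decreasing size: a finite family of sets has a disjoint subfamily such
that every member meets a selected one that is at least as large. -/
theorem exists_pairwiseDisjoint_dominating {ι α : Type*} (K : ι → Set α)
    (δ : ι → ℝ) (hne : ∀ i, (K i).Nonempty) (s : Finset ι) :
    ∃ P ⊆ s, (P : Set ι).PairwiseDisjoint K ∧
      ∀ i ∈ s, ∃ j ∈ P, (K i ∩ K j).Nonempty ∧ δ i ≤ δ j := by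
  classical
  induction s using Finset.strongInduction with
  | H s ih =>
    rcases s.eq_empty_or_nonempty with rfl | hs
    · exact ⟨∅, by simp⟩
    · obtain ⟨m, hm, hmax⟩ := s.exists_max_image δ hs
      have hsub : s.filter (fun i => ¬ (K i ∩ K m).Nonempty) ⊂ s := by
        refine Finset.filter_ssubset.2 ⟨m, hm, ?_⟩
        simpa using hne m
      obtain ⟨P, hP, hdis, hdom⟩ := ih _ hsub
      refine ⟨insert m P, ?_, ?_, ?_⟩
      · exact Finset.insert_subset hm (hP.trans (Finset.filter_subset _ _))
      · rw [Finset.coe_insert]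
        refine hdis.insert fun j hj _ => ?_
        have := (Finset.mem_filter.1 (hP hj)).2
        rw [Set.disjoint_iff_inter_eq_empty, Set.inter_comm]
        exact Set.not_nonempty_iff_eq_empty.1 this
      · intro i hi
        by_cases h : (K i ∩ K m).Nonempty
        · exact ⟨m, Finset.mem_insert_self _ _, h, hmax i hi⟩
        · obtain ⟨j, hj, h'⟩ := hdom i (Finset.mem_filter.2 ⟨hi, h⟩)
          exact ⟨j, Finset.mem_insert_of_mem hj, h'⟩

/-! ### Families of fat bodies -/

/-- A family of compact convex sets in `ℝᵈ`, each squeezed between two concentric balls whose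
radii have ratio `D`. -/
structure FatFamily (d : ℕ) (V : Type*) (D : ℝ) where
  body : V → Set (EuclideanSpace ℝ (Fin d))
  center : V → EuclideanSpace ℝ (Fin d)
  radius : V → ℝ
  convex : ∀ v, Convex ℝ (body v)
  isCompact : ∀ v, IsCompact (body v)
  radius_pos : ∀ v, 0 < radius v
  ball_subset : ∀ v, Metric.closedBall (center v) (radius v) ⊆ body v
  subset_ball : ∀ v, body v ⊆ Metric.closedBall (center v) (D * radius v)

namespace FatFamily

variable {d : ℕ} {V : Type*} {D : ℝ} (F : FatFamily d V D)

/-- The intersection graph of the boundaries of the bodies. -/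
abbrev graph : SimpleGraph V := intersectionGraph fun v => frontier (F.body v)

/-- The Lebesgue measure of a body of the family. -/
noncomputable def vol (v : V) : ℝ :=
  (volume : Measure (EuclideanSpace ℝ (Fin d))).real (F.body v)

theorem center_mem (v : V) : F.center v ∈ F.body v :=
  F.ball_subset v (Metric.mem_closedBall_self (F.radius_pos v).le)

theorem frontier_subset (v : V) : frontier (F.body v) ⊆ F.body v :=
  (F.isCompact v).isClosed.frontier_subset

theorem nontrivial_space (hd : 2 ≤ d) : Nontrivial (EuclideanSpace ℝ (Fin d)) :=
  Module.nontrivial_of_finrank_pos (R := ℝ) (by rw [finrank_euclideanSpace_fin]; omega)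

theorem isConnected_frontier (hd : 2 ≤ d) (v : V) : IsConnected (frontier (F.body v)) := by
  refine isConnected_frontier_of_convex ?_ (F.convex v) ?_ (F.isCompact v).isBounded
  · rw [← Module.finrank_eq_rank, finrank_euclideanSpace_fin]
    exact_mod_cast hd
  · refine ⟨F.center v, ?_⟩
    exact interior_mono (F.ball_subset v)
      (Metric.ball_subset_interior_closedBall (Metric.mem_ball_self (F.radius_pos v)))

theorem vol_lt_vol (hd : 2 ≤ d) {u v : V} (h : frontier (F.body u) ⊆ interior (F.body v)) :
    F.vol u < F.vol v := by
  have := nontrivial_space hd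
  exact measureReal_lt_of_subset_interior _ (F.isCompact u) (F.isCompact v) ⟨_, F.center_mem u⟩
    (subset_of_frontier_subset (F.isCompact u).isClosed (F.isCompact u).isBounded
      (F.convex v).interior h)

/-- Volume controls the radius, up to the fatness constant. -/
theorem radius_le_of_vol_le (hd : 2 ≤ d) (hD : 1 ≤ D) {u v : V} (h : F.vol u ≤ F.vol v) :
    F.radius u ≤ D * F.radius v := by
  have hd0 : d ≠ 0 := by omega
  set μ : Measure (EuclideanSpace ℝ (Fin d)) := volume
  have hball : ∀ (y : EuclideanSpace ℝ (Fin d)) {r : ℝ}, 0 ≤ r →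
      μ.real (Metric.closedBall y r) = r ^ d * μ.real (Metric.closedBall 0 1) := by
    intro y r hr
    rw [Measure.addHaar_real_closedBall' μ y hr, finrank_euclideanSpace_fin]
  have hunit : 0 < μ.real (Metric.closedBall (0 : EuclideanSpace ℝ (Fin d)) 1) :=
    ENNReal.toReal_pos (Metric.measure_closedBall_pos μ _ one_pos).ne'
      measure_closedBall_lt_top.ne
  have hv : 0 ≤ D * F.radius v := mul_nonneg (by linarith) (F.radius_pos v).le
  have h1 : μ.real (Metric.closedBall (F.center u) (F.radius u)) ≤ F.vol u :=
    measureReal_mono (F.ball_subset u) (F.isCompact u).measure_lt_top.ne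
  have h2 : F.vol v ≤ μ.real (Metric.closedBall (F.center v) (D * F.radius v)) :=
    measureReal_mono (F.subset_ball v) measure_closedBall_lt_top.ne
  rw [hball _ (F.radius_pos u).le] at h1
  rw [hball _ hv] at h2
  exact le_of_pow_le_pow_left₀ hd0 hv (le_of_mul_le_mul_right (h1.trans (h.trans h2)) hunit)

/-- If two bodies meet and their boundaries do not, the smaller one is inside the larger one. -/
theorem subset_interior_of_vol_le (hd : 2 ≤ d) {u v : V}
    (hdis : Disjoint (frontier (F.body u)) (frontier (F.body v)))
    (hne : (F.body u ∩ F.body v).Nonempty) (h : F.vol u ≤ F.vol v) :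
    F.body u ⊆ interior (F.body v) := by
  have := nontrivial_space hd
  rcases subset_interior_or_of_disjoint_frontier (F.convex v) (F.isCompact u)
    (F.isCompact v) (F.isConnected_frontier hd u) hdis hne with h1 | h1
  · exact h1
  · exact absurd h (not_le.2 (F.vol_lt_vol hd ((F.frontier_subset v).trans h1)))

/-- A body meeting a larger one stays in a fixed enlargement of it. -/
theorem subset_closedBall_of_vol_le (hd : 2 ≤ d) (hD : 1 ≤ D) {u v : V}
    (hne : (F.body u ∩ F.body v).Nonempty) (h : F.vol u ≤ F.vol v) :
    F.body u ⊆ Metric.closedBall (F.center v) (3 * D ^ 2 * F.radius v) := by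
  intro p hp
  obtain ⟨z, hzu, hzv⟩ := hne
  have h1 : dist p (F.center u) ≤ D * F.radius u := F.subset_ball u hp
  have h2 : dist z (F.center u) ≤ D * F.radius u := F.subset_ball u hzu
  have h3 : dist z (F.center v) ≤ D * F.radius v := F.subset_ball v hzv
  have h4 := F.radius_le_of_vol_le hd hD h
  have h5 : dist p (F.center v)
      ≤ dist p (F.center u) + dist (F.center u) z + dist z (F.center v) := dist_triangle4 _ _ _ _
  rw [dist_comm (F.center u) z] at h5
  have h6 : D * F.radius u ≤ D * (D * F.radius v) :=
    mul_le_mul_of_nonneg_left h4 (by linarith)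
  have h7 : D * F.radius v ≤ D * (D * F.radius v) :=
    mul_le_mul_of_nonneg_left (by nlinarith [F.radius_pos v]) (by linarith)
  rw [Metric.mem_closedBall]
  nlinarith

/-- Disjoint bodies that meet a ball of radius `2r`, with radii truncated at `r`, satisfy a volume
bound: the truncation is harmless since a large body contains a ball of radius `r` near the
point where it meets the given ball. -/
theorem sum_min_radius_pow_le (hD : 1 ≤ D) {P : Finset V}
    (hP : (P : Set V).PairwiseDisjoint F.body) (x : EuclideanSpace ℝ (Fin d)) {r : ℝ}
    (hr : 0 < r) (hmeet : ∀ v ∈ P, (F.body v ∩ Metric.closedBall x (2 * r)).Nonempty) :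
    ∑ v ∈ P, min 1 (F.radius v / r) ^ d ≤ (3 + D) ^ d := by
  have hw : ∀ v, 0 < min 1 (F.radius v / r) := fun v =>
    lt_min one_pos (div_pos (F.radius_pos v) hr)
  have key : ∀ v : V, ∃ z, v ∈ P →
      Metric.closedBall z (r * min 1 (F.radius v / r)) ⊆ F.body v ∧
      Metric.closedBall z (r * min 1 (F.radius v / r)) ⊆ Metric.closedBall x ((3 + D) * r) := by
    intro v
    by_cases hv : v ∈ P
    · obtain ⟨p, hpv, hpx⟩ := hmeet v hv
      have hle : r * min 1 (F.radius v / r) ≤ F.radius v :=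
        (mul_le_mul_of_nonneg_left (min_le_right _ _) hr.le).trans_eq (by field_simp)
      have hle' : r * min 1 (F.radius v / r) ≤ r :=
        (mul_le_mul_of_nonneg_left (min_le_left _ _) hr.le).trans_eq (mul_one r)
      obtain ⟨z, hz, hzp⟩ := exists_closedBall_subset_near (F.convex v) (F.ball_subset v)
        (F.subset_ball v) hpv (mul_pos hr (hw v)) hle
      refine ⟨z, fun _ => ⟨hz, Metric.closedBall_subset_closedBall' ?_⟩⟩
      have h1 : dist z x ≤ dist z p + dist p x := dist_triangle _ _ _
      have h2 : dist p x ≤ 2 * r := hpx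
      have h3 : D * (r * min 1 (F.radius v / r)) ≤ D * r :=
        mul_le_mul_of_nonneg_left hle' (by linarith)
      linarith
    · exact ⟨0, fun h => absurd h hv⟩
  choose z hz using key
  have h := sum_radius_pow_le P z (fun v => r * min 1 (F.radius v / r))
    (fun v _ => (mul_pos hr (hw v)).le) x (M := (3 + D) * r) (by positivity)
    (fun u hu v hv huv => (hP hu hv huv).mono (hz u hu).1 (hz v hv).1)
    (fun v hv => (hz v hv).2)
  simp only [mul_pow, ← Finset.mul_sum] at h
  rw [mul_comm] at h
  exact le_of_mul_le_mul_right h (by positivity)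

end FatFamily

/-! ### Cutting around a ball -/

namespace FatFamily

/-- The constant in the bound for the number of vertices deleted around one ball. -/
def cutConst (d : ℕ) (D : ℝ) : ℝ := 2 + 6 * D ^ 2 * (1 + 2 * (3 + D) ^ d)

theorem two_le_cutConst (d : ℕ) {D : ℝ} (hD : 1 ≤ D) : 2 ≤ cutConst d D := by
  have : 0 ≤ 6 * D ^ 2 * (1 + 2 * (3 + D) ^ d) := by positivity
  unfold cutConst
  linarith

variable {d : ℕ} {V : Type*} [Fintype V] {D : ℝ} (F : FatFamily d V D)

/-- The expected cost of a cut at a random radius. A heavy vertex `v` has `deg v > T w ^ (d-1)`,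
where `w` is its radius relative to `r`, truncated at `1`; it is deleted at cost `1`. A
selected light vertex is deleted together with its neighbours. -/
theorem sum_cost_le (hd : 2 ≤ d) (hD : 1 ≤ D) {T : ℝ} (hT : 1 ≤ T)
    (hsum : ∑ v, ((F.graph.degree v : ℝ) / T) ^ (1 / ((d : ℝ) - 1)) ≤ T)
    (x : EuclideanSpace ℝ (Fin d)) {r : ℝ} (hr : 0 < r) (H P : Finset V)
    (hH : ∀ v ∈ H, T * min 1 (F.radius v / r) ^ (d - 1) < F.graph.degree v)
    (hP : (P : Set V).PairwiseDisjoint F.body)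
    (hmeet : ∀ v ∈ P, (F.body v ∩ Metric.closedBall x (2 * r)).Nonempty)
    (hdeg : ∀ v ∈ P, 1 ≤ F.graph.degree v)
    (hlight : ∀ v ∈ P, (F.graph.degree v : ℝ) ≤ T * min 1 (F.radius v / r) ^ (d - 1)) :
    ∑ v ∈ H, min 1 (F.radius v / r) +
      ∑ v ∈ P, ((F.graph.degree v : ℝ) + 1) * min 1 (F.radius v / r) ≤
        (1 + 2 * (3 + D) ^ d) * T := by
  have hw : ∀ v, 0 < min 1 (F.radius v / r) := fun v =>
    lt_min one_pos (div_pos (F.radius_pos v) hr)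
  have hT0 : 0 < T := by linarith
  have hcast : ((d - 1 : ℕ) : ℝ) = (d : ℝ) - 1 := by
    rw [Nat.cast_sub (by omega), Nat.cast_one]
  have h1 : ∑ v ∈ H, min 1 (F.radius v / r) ≤ T := by
    refine le_trans ?_ hsum
    refine (Finset.sum_le_sum (fun v hv => ?_)).trans
      (Finset.sum_le_univ_sum_of_nonneg fun v => by positivity)
    have h2 : min 1 (F.radius v / r) ^ (d - 1) ≤ (F.graph.degree v : ℝ) / T := by
      rw [le_div_iff₀ hT0, mul_comm]
      exact (hH v hv).le
    calc min 1 (F.radius v / r)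
        = (min 1 (F.radius v / r) ^ (d - 1)) ^ (1 / ((d : ℝ) - 1)) := by
          rw [one_div, ← hcast, Real.pow_rpow_inv_natCast (hw v).le (by omega)]
      _ ≤ _ := Real.rpow_le_rpow (pow_nonneg (hw v).le _) h2 (by
          rw [← hcast]; positivity)
  have h3 : ∑ v ∈ P, ((F.graph.degree v : ℝ) + 1) * min 1 (F.radius v / r)
      ≤ 2 * T * (3 + D) ^ d := by
    calc _ ≤ ∑ v ∈ P, 2 * T * min 1 (F.radius v / r) ^ d := by
          refine Finset.sum_le_sum fun v hv => ?_
          have h4 : (1 : ℝ) ≤ F.graph.degree v := by exact_mod_cast hdeg v hv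
          have h5 : min 1 (F.radius v / r) ^ d
              = min 1 (F.radius v / r) ^ (d - 1) * min 1 (F.radius v / r) := by
            rw [← pow_succ]
            congr 1
            omega
          rw [h5, ← mul_assoc]
          refine mul_le_mul_of_nonneg_right ?_ (hw v).le
          linarith [hlight v hv]
      _ = 2 * T * ∑ v ∈ P, min 1 (F.radius v / r) ^ d := by rw [Finset.mul_sum]
      _ ≤ _ := by
          gcongr
          exact F.sum_min_radius_pow_le hD hP x hr hmeet
  linarith

theorem isConnected_iUnion_haven (hd : 2 ≤ d) {t : ℝ} {β : Finset V → Set V}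
    (h : IsHaven F.graph t β) {X : Finset V} (hX : (X.card : ℝ) ≤ t) :
    IsConnected (⋃ v ∈ β X, frontier (F.body v)) := by
  refine IsConnected.biUnion_of_reflTransGen (h.nonempty hX)
    (fun v _ => F.isConnected_frontier hd v) fun u hu v hv => ?_
  exact Relation.ReflTransGen.mono (fun a b hab => ⟨hab.1.2, hab.2.1⟩) _ _ (h.chain X hX u hu v hv)

variable [DecidableEq V]

/-- A vertex of the intersection graph together with its neighbours. -/
noncomputable def closedNbhd (v : V) : Finset V := insert v (F.graph.neighborFinset v)

theorem card_closedNbhd (v : V) : (F.closedNbhd v).card = F.graph.degree v + 1 := by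
  rw [closedNbhd, Finset.card_insert_of_notMem (by simp), SimpleGraph.card_neighborFinset_eq_degree]

theorem disjoint_frontier_of_notMem_closedNbhd {u v : V} (h : u ∉ F.closedNbhd v) :
    Disjoint (frontier (F.body u)) (frontier (F.body v)) := by
  rw [closedNbhd, Finset.mem_insert, SimpleGraph.mem_neighborFinset, not_or] at h
  rw [Set.disjoint_iff_inter_eq_empty, Set.inter_comm]
  exact Set.not_nonempty_iff_eq_empty.1 fun hne => h.2 ⟨fun huv => h.1 huv.symm, hne⟩

/-- Deleting the closed neighbourhood of `v` leaves the large component entirely inside or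
entirely outside the body of `v`. -/
theorem haven_inside_or_outside (hd : 2 ≤ d) {t : ℝ} {β : Finset V → Set V}
    (h : IsHaven F.graph t β) {v : V} (hv : ((F.closedNbhd v).card : ℝ) ≤ t) :
    (∀ u ∈ β (F.closedNbhd v), frontier (F.body u) ⊆ interior (F.body v)) ∨
      ∀ u ∈ β (F.closedNbhd v), frontier (F.body u) ⊆ (F.body v)ᶜ := by
  have hdis : Disjoint (⋃ u ∈ β (F.closedNbhd v), frontier (F.body u)) (frontier (F.body v)) := by
    simp only [Set.disjoint_iUnion_left]
    exact fun u hu => F.disjoint_frontier_of_notMem_closedNbhd (h.avoid _ hv u hu)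
  rcases (F.isConnected_iUnion_haven hd h hv).isPreconnected.subset_interior_or_subset_compl
    (F.isCompact v).isClosed hdis with h1 | h1
  · exact Or.inl fun u hu =>
      (Set.subset_biUnion_of_mem (u := fun u => frontier (F.body u)) hu).trans h1
  · exact Or.inr fun u hu =>
      (Set.subset_biUnion_of_mem (u := fun u => frontier (F.body u)) hu).trans h1

/-- Among the vertices of degree at most `T` whose body contains the large component, one of
smallest volume is enough: after deleting its closed neighbourhood, the large component contains
no vertex of this kind. -/
theorem exists_cut_inner (hd : 2 ≤ d) {t T : ℝ} (hT : 1 ≤ T) (hTt : 2 * T ≤ t)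
    {β : Finset V → Set V} (h : IsHaven F.graph t β) :
    ∃ X₀ : Finset V, (X₀.card : ℝ) ≤ 2 * T ∧ ∀ X, X₀ ⊆ X → (X.card : ℝ) ≤ t → ∀ v ∈ β X,
      (F.graph.degree v : ℝ) ≤ T →
        ∀ u ∈ β (F.closedNbhd v), frontier (F.body u) ⊆ (F.body v)ᶜ := by
  classical
  have hcard : ∀ v, (F.graph.degree v : ℝ) ≤ T → ((F.closedNbhd v).card : ℝ) ≤ 2 * T := by
    intro v hv
    rw [card_closedNbhd]
    push_cast
    linarith
  set I : Finset V := Finset.univ.filter fun v => (F.graph.degree v : ℝ) ≤ T ∧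
    ∀ u ∈ β (F.closedNbhd v), frontier (F.body u) ⊆ interior (F.body v) with hI
  rcases I.eq_empty_or_nonempty with hem | hne
  · refine ⟨∅, by simp; linarith, fun X _ _ v _ hdeg => ?_⟩
    refine (F.haven_inside_or_outside hd h ((hcard v hdeg).trans hTt)).resolve_left fun hin => ?_
    have : v ∈ I := by simp [hI, hdeg]; exact hin
    rw [hem] at this
    exact absurd this (Finset.notMem_empty v)
  · obtain ⟨m, hm, hmin⟩ := I.exists_min_image F.vol hne
    rw [hI, Finset.mem_filter] at hm
    refine ⟨F.closedNbhd m, hcard m hm.2.1, fun X hX hXt v hv hdeg => ?_⟩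
    refine (F.haven_inside_or_outside hd h ((hcard v hdeg).trans hTt)).resolve_left fun hin => ?_
    have h1 := hm.2.2 v (h.antitone hX hXt hv)
    exact absurd (hmin v (by simp [hI, hdeg]; exact hin)) (not_le.2 (F.vol_lt_vol hd h1))

/-- For every ball there is a small vertex set whose deletion confines the large component to the
concentric ball of twice the radius, or keeps it away from the ball. -/
theorem exists_cut (hd : 2 ≤ d) (hD : 1 ≤ D) (hn : 2 ≤ Fintype.card V) {t T : ℝ} (hT : 1 ≤ T)
    (hsum : ∑ v, ((F.graph.degree v : ℝ) / T) ^ (1 / ((d : ℝ) - 1)) ≤ T)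
    (hTt : cutConst d D * T ≤ t) {β : Finset V → Set V} (h : IsHaven F.graph t β)
    (x : EuclideanSpace ℝ (Fin d)) {r : ℝ} (hr : 0 < r) :
    ∃ X : Finset V, (X.card : ℝ) ≤ cutConst d D * T ∧
      ((∀ v ∈ β X, frontier (F.body v) ⊆ Metric.ball x (2 * r)) ∨
        ∀ v ∈ β X, Disjoint (frontier (F.body v)) (Metric.closedBall x r)) := by
  classical
  have hw : ∀ v, 0 < min 1 (F.radius v / r) := fun v =>
    lt_min one_pos (div_pos (F.radius_pos v) hr)
  have h2T : 2 * T ≤ t := by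
    have := two_le_cutConst d hD
    nlinarith
  obtain ⟨X₀, hX₀, hinner⟩ := F.exists_cut_inner hd hT h2T h
  set Q : Finset V := Finset.univ.filter fun v =>
    (F.graph.degree v : ℝ) ≤ T * min 1 (F.radius v / r) ^ (d - 1) ∧ 1 ≤ F.graph.degree v ∧
    (∀ u ∈ β (F.closedNbhd v), frontier (F.body u) ⊆ (F.body v)ᶜ) ∧
    (F.body v ∩ Metric.closedBall x (2 * r)).Nonempty with hQ
  obtain ⟨P, hPQ, hPdis, hPdom⟩ := exists_pairwiseDisjoint_dominating F.body F.vol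
    (fun v => ⟨_, F.center_mem v⟩) Q
  have hPQ' : ∀ v ∈ P, _ := fun v hv => (Finset.mem_filter.1 (hPQ hv)).2
  set H : Finset V := Finset.univ.filter fun v =>
    T * min 1 (F.radius v / r) ^ (d - 1) < F.graph.degree v with hH
  have hHP : Disjoint H P := by
    rw [Finset.disjoint_left]
    intro v hvH hvP
    exact absurd (hPQ' v hvP).1 (not_le.2 (Finset.mem_filter.1 hvH).2)
  have hcost := F.sum_cost_le hd hD hT hsum x hr H P (fun v hv => (Finset.mem_filter.1 hv).2)
    hPdis (fun v hv => (hPQ' v hv).2.2.2) (fun v hv => (hPQ' v hv).2.1)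
    (fun v hv => (hPQ' v hv).1)
  -- The set deleted on account of `v` when the sphere of radius `ρ` comes near the body of `v`.
  set Y : V → Finset V := fun v => if v ∈ H then {v} else F.closedNbhd v with hY
  obtain ⟨ρ, hρ, hρcost⟩ := exists_sum_filter_abs_sub_le (H ∪ P) (fun v => dist (F.center v) x)
    (fun v => 3 * D ^ 2 * F.radius v) (fun v => ((Y v).card : ℝ)) (fun v _ => by positivity)
    (fun v _ => by have := F.radius_pos v; positivity) hr
  set X : Finset V := X₀ ∪ ((H ∪ P).filter fun v =>
    |ρ - dist (F.center v) x| ≤ 3 * D ^ 2 * F.radius v).biUnion Y with hX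
  have hXcard : (X.card : ℝ) ≤ cutConst d D * T := by
    have h1 : (X.card : ℝ) ≤ X₀.card + ∑ v ∈ (H ∪ P).filter fun v =>
        |ρ - dist (F.center v) x| ≤ 3 * D ^ 2 * F.radius v, ((Y v).card : ℝ) := by
      exact_mod_cast (Finset.card_union_le _ _).trans
        (Nat.add_le_add_left Finset.card_biUnion_le _)
    have h2 : ∑ v ∈ H ∪ P, ((Y v).card : ℝ) * (min r (2 * (3 * D ^ 2 * F.radius v)) / r)
        ≤ 6 * D ^ 2 * ((1 + 2 * (3 + D) ^ d) * T) := by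
      refine le_trans ?_ (mul_le_mul_of_nonneg_left hcost (by positivity))
      rw [Finset.sum_union hHP, mul_add, Finset.mul_sum, Finset.mul_sum]
      have h3 : ∀ v, min r (2 * (3 * D ^ 2 * F.radius v)) / r
          ≤ 6 * D ^ 2 * min 1 (F.radius v / r) := by
        intro v
        have h6 : (1 : ℝ) ≤ 6 * D ^ 2 := by nlinarith
        rw [mul_min_of_nonneg _ _ (by positivity : (0 : ℝ) ≤ 6 * D ^ 2)]
        refine le_min ?_ ?_
        · rw [mul_one]
          refine le_trans ((div_le_one hr).2 (min_le_left _ _)) h6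
        · rw [← mul_div_assoc]
          refine div_le_div_of_nonneg_right ((min_le_right _ _).trans_eq (by ring)) hr.le
      refine add_le_add (Finset.sum_le_sum fun v hv => ?_) (Finset.sum_le_sum fun v hv => ?_)
      · simp only [hY, if_pos hv, Finset.card_singleton, Nat.cast_one, one_mul]
        exact h3 v
      · have hvH : v ∉ H := fun hvH => Finset.disjoint_left.1 hHP hvH hv
        simp only [hY, if_neg hvH, F.card_closedNbhd]
        push_cast
        calc _ ≤ ((F.graph.degree v : ℝ) + 1) * (6 * D ^ 2 * min 1 (F.radius v / r)) := by
              gcongr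
              exact h3 v
          _ = _ := by ring
    have h4 : (X.card : ℝ) ≤ 2 * T + 6 * D ^ 2 * ((1 + 2 * (3 + D) ^ d) * T) := by
      linarith [hρcost.trans h2]
    refine h4.trans_eq ?_
    unfold cutConst
    ring
  have hXt := hXcard.trans hTt
  have hYX : ∀ v ∈ H ∪ P, |ρ - dist (F.center v) x| ≤ 3 * D ^ 2 * F.radius v → Y v ⊆ X :=
    fun v hv hvρ => (Finset.subset_biUnion_of_mem Y (Finset.mem_filter.2 ⟨hv, hvρ⟩)).trans
      Finset.subset_union_right
  have hnear : ∀ v p, dist p x = ρ → p ∈ Metric.closedBall (F.center v) (3 * D ^ 2 * F.radius v) →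
      |ρ - dist (F.center v) x| ≤ 3 * D ^ 2 * F.radius v := by
    intro v p hp hpv
    rw [← hp]
    exact (abs_dist_sub_le p (F.center v) x).trans hpv
  have havoid : ∀ v ∈ β X, ∀ p ∈ frontier (F.body v), dist p x ≠ ρ := by
    intro v hv p hp hpx
    have hvX := h.avoid X hXt v hv
    have hself : v ∈ Y v := by
      by_cases hvH : v ∈ H <;> simp [hY, hvH, closedNbhd]
    have hpK := F.frontier_subset v hp
    by_cases hvH : v ∈ H
    · refine hvX (hYX v (Finset.mem_union_left _ hvH) (hnear v p hpx ?_) hself)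
      exact F.subset_closedBall_of_vol_le hd hD ⟨_, F.center_mem v, F.center_mem v⟩ le_rfl hpK
    · have hlight : (F.graph.degree v : ℝ) ≤ T * min 1 (F.radius v / r) ^ (d - 1) := by
        simpa [hH] using hvH
      have hlow : (F.graph.degree v : ℝ) ≤ T := hlight.trans
        (mul_le_of_le_one_right (by linarith) (pow_le_one₀ (hw v).le (min_le_left _ _)))
      have hdeg : 1 ≤ F.graph.degree v := by
        obtain ⟨u, hu⟩ := h.exists_adj hn hXt hv
        exact (SimpleGraph.degree_pos_iff_exists_adj _ _).2 ⟨u, hu⟩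
      have hout := hinner X Finset.subset_union_left hXt v hv hlow
      have hvQ : v ∈ Q := Finset.mem_filter.2 ⟨Finset.mem_univ v, hlight, hdeg, hout,
        ⟨p, hpK, by rw [Metric.mem_closedBall, hpx]; exact hρ.2⟩⟩
      obtain ⟨m, hmP, hne, hvol⟩ := hPdom v hvQ
      have hmH : m ∉ H := fun hmH => Finset.disjoint_left.1 hHP hmH hmP
      have hsub : F.closedNbhd m ⊆ X := by
        have := hYX m (Finset.mem_union_right _ hmP)
          (hnear m p hpx (F.subset_closedBall_of_vol_le hd hD hne hvol hpK))
        simpa only [hY, if_neg hmH] using this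
      have hin := F.subset_interior_of_vol_le hd
        (F.disjoint_frontier_of_notMem_closedNbhd fun hmem => hvX (hsub hmem)) hne hvol
      exact (hPQ' m hmP).2.2.1 v (h.antitone hsub hXt hv) hp (interior_subset (hin hpK))
  refine ⟨X, hXcard, ?_⟩
  have hconn := (F.isConnected_iUnion_haven hd h hXt).isPreconnected
  have hsplit : (⋃ v ∈ β X, frontier (F.body v)) ⊆ Metric.ball x ρ ∪ (Metric.closedBall x ρ)ᶜ := by
    refine Set.iUnion₂_subset fun v hv p hp => ?_
    rcases lt_trichotomy (dist p x) ρ with h1 | h1 | h1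
    · exact Or.inl h1
    · exact absurd h1 (havoid v hv p hp)
    · exact Or.inr fun h2 => absurd h1 (not_lt.2 h2)
  rcases hconn.subset_or_subset Metric.isOpen_ball Metric.isClosed_closedBall.isOpen_compl
    (Set.disjoint_compl_right_iff_subset.2 Metric.ball_subset_closedBall) hsplit with h1 | h1
  · refine Or.inl fun v hv => ?_
    exact ((Set.subset_biUnion_of_mem (u := fun u => frontier (F.body u)) hv).trans h1).trans
      (Metric.ball_subset_ball hρ.2)
  · refine Or.inr fun v hv => Set.disjoint_left.2 fun p hp hpx => ?_
    exact ((Set.subset_biUnion_of_mem (u := fun u => frontier (F.body u)) hv).trans h1) hp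
      (Metric.closedBall_subset_closedBall hρ.1 hpx)

end FatFamily

/-! ### Descending to small balls -/

/-- Every ball of radius `2r` is covered by a bounded number of balls of radius `r / 2`. -/
theorem exists_finset_cover (d : ℕ) : ∃ s : Finset (EuclideanSpace ℝ (Fin d)),
    ∀ (x p : EuclideanSpace ℝ (Fin d)) (r : ℝ), 0 < r → dist p x < 2 * r →
      ∃ y ∈ s, dist p (x + r • y) ≤ r / 2 := by
  obtain ⟨s, -, hfin, hs⟩ :=
    (isCompact_closedBall (0 : EuclideanSpace ℝ (Fin d)) 2).finite_cover_balls
      (e := 1 / 2) (by norm_num)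
  refine ⟨hfin.toFinset, fun x p r hr hp => ?_⟩
  have h1 : r⁻¹ • (p - x) ∈ Metric.closedBall (0 : EuclideanSpace ℝ (Fin d)) 2 := by
    rw [mem_closedBall_zero_iff, norm_smul, Real.norm_eq_abs, abs_of_pos (inv_pos.2 hr),
      ← dist_eq_norm, inv_mul_le_iff₀ hr, mul_comm]
    exact hp.le
  obtain ⟨y, hy, hy'⟩ := Set.mem_iUnion₂.1 (hs h1)
  refine ⟨y, hfin.mem_toFinset.2 hy, ?_⟩
  have h2 : p - (x + r • y) = r • (r⁻¹ • (p - x) - y) := by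
    rw [smul_sub, smul_inv_smul₀ hr.ne']
    abel
  rw [dist_eq_norm, h2, norm_smul, Real.norm_eq_abs, abs_of_pos hr, ← dist_eq_norm]
  have h3 : dist (r⁻¹ • (p - x)) y < 1 / 2 := hy'
  nlinarith

namespace FatFamily

/-- If `T ≥ 1` satisfies the degree condition, the intersection graph has a balanced separator of
size `O(T)`: otherwise a haven would be confined to arbitrarily small balls. -/
theorem exists_isBalancedSeparator (d : ℕ) (hd : 2 ≤ d) {D : ℝ} (hD : 1 ≤ D) :
    ∃ A : ℝ, 0 < A ∧ ∀ (V : Type) [Fintype V] [DecidableEq V] (F : FatFamily d V D) (T : ℝ),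
      2 ≤ Fintype.card V → 1 ≤ T →
      ∑ v, ((F.graph.degree v : ℝ) / T) ^ (1 / ((d : ℝ) - 1)) ≤ T →
      ∃ X : Finset V, IsBalancedSeparator F.graph X ∧ (X.card : ℝ) ≤ A * T := by
  obtain ⟨s, hs⟩ := exists_finset_cover d
  have hc := two_le_cutConst d hD
  refine ⟨(s.card + 1) * cutConst d D, by positivity, ?_⟩
  intro V _ _ F T hn hT hsum
  by_contra hcon
  push Not at hcon
  have := nontrivial_space hd
  set t : ℝ := (s.card + 1) * cutConst d D * T with ht
  have hcT : 0 ≤ cutConst d D * T := by positivity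
  have hTt : cutConst d D * T ≤ t := by
    have : (0 : ℝ) ≤ s.card := by positivity
    nlinarith
  have ht0 : 0 ≤ t := hcT.trans hTt
  obtain ⟨β, h⟩ := exists_isHaven F.graph t fun X hX hsep => absurd hX (not_le.2 (hcon X hsep))
  set Ins : EuclideanSpace ℝ (Fin d) → ℝ → Prop := fun x r =>
    ∃ X : Finset V, (X.card : ℝ) ≤ cutConst d D * T ∧
      ∀ v ∈ β X, frontier (F.body v) ⊆ Metric.ball x (2 * r) with hIns
  have hstep : ∀ x r, 0 < r → Ins x r → ∃ y, Ins y (r / 2) := by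
    rintro x r hr ⟨X, hX, hXβ⟩
    by_contra hno
    push Not at hno
    have key : ∀ y, ∃ Z : Finset V, (Z.card : ℝ) ≤ cutConst d D * T ∧
        ∀ v ∈ β Z, Disjoint (frontier (F.body v)) (Metric.closedBall y (r / 2)) := by
      intro y
      obtain ⟨Z, hZ, hZβ⟩ := F.exists_cut hd hD hn hT hsum hTt h y (half_pos hr)
      exact ⟨Z, hZ, hZβ.resolve_left fun hin => hno y ⟨Z, hZ, hin⟩⟩
    choose Z hZ hZβ using key
    set W : Finset V := X ∪ s.biUnion fun y => Z (x + r • y) with hW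
    have hWt : (W.card : ℝ) ≤ t := by
      have h1 : (W.card : ℝ) ≤ X.card + ∑ y ∈ s, ((Z (x + r • y)).card : ℝ) := by
        exact_mod_cast (Finset.card_union_le _ _).trans
          (Nat.add_le_add_left Finset.card_biUnion_le _)
      have h2 := Finset.sum_le_card_nsmul s (fun y => ((Z (x + r • y)).card : ℝ))
        (cutConst d D * T) fun y _ => hZ _
      rw [nsmul_eq_mul] at h2
      rw [ht]
      linarith
    obtain ⟨v, hv⟩ := h.nonempty hWt
    obtain ⟨p, hp⟩ := (F.isConnected_frontier hd v).nonempty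
    have hpx := hXβ v (h.antitone Finset.subset_union_left hWt hv) hp
    obtain ⟨y, hys, hy⟩ := hs x p r hr hpx
    have hsub : Z (x + r • y) ⊆ W :=
      (Finset.subset_biUnion_of_mem (fun y => Z (x + r • y)) hys).trans Finset.subset_union_right
    exact Set.disjoint_left.1 (hZβ _ v (h.antitone hsub hWt hv)) hp hy
  have hV : Nonempty V := Fintype.card_pos_iff.1 (by omega)
  obtain ⟨r₀, hr₀, hinit⟩ : ∃ r₀ : ℝ, 0 < r₀ ∧ Ins 0 r₀ := by
    have hb : Bornology.IsBounded (⋃ v, F.body v) :=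
      Bornology.isBounded_iUnion.2 fun v => (F.isCompact v).isBounded
    obtain ⟨ρ, hρ0, hρ⟩ := hb.subset_ball_lt 0 0
    refine ⟨ρ, hρ0, ∅, by simpa using hcT, fun v _ => ?_⟩
    refine (F.frontier_subset v).trans ((Set.subset_iUnion _ v).trans (hρ.trans ?_))
    exact Metric.ball_subset_ball (by linarith)
  have hall : ∀ k : ℕ, ∃ x, Ins x (r₀ / 2 ^ k) := by
    intro k
    induction k with
    | zero => exact ⟨0, by simpa using hinit⟩
    | succ k ih =>
      obtain ⟨x, hx⟩ := ih
      obtain ⟨y, hy⟩ := hstep x _ (by positivity) hx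
      exact ⟨y, by rwa [pow_succ, ← div_div]⟩
  obtain ⟨m, -, hm⟩ := Finset.exists_min_image Finset.univ F.radius Finset.univ_nonempty
  obtain ⟨k, hk⟩ : ∃ k : ℕ, 4 * r₀ / F.radius m < 2 ^ k := pow_unbounded_of_one_lt _ one_lt_two
  obtain ⟨x, X, hX, hXβ⟩ := hall k
  obtain ⟨v, hv⟩ := h.nonempty (hX.trans hTt)
  have hbody : F.body v ⊆ Metric.ball x (2 * (r₀ / 2 ^ k)) :=
    subset_of_frontier_subset (F.isCompact v).isClosed (F.isCompact v).isBounded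
      (convex_ball _ _) (hXβ v hv)
  obtain ⟨e, he⟩ := exists_norm_eq (EuclideanSpace ℝ (Fin d)) (F.radius_pos v).le
  have h1 : dist (F.center v) x < 2 * (r₀ / 2 ^ k) := hbody (F.center_mem v)
  have h2 : dist (F.center v + e) x < 2 * (r₀ / 2 ^ k) :=
    hbody (F.ball_subset v (by simp [he]))
  have h3 : F.radius v ≤ dist (F.center v + e) x + dist (F.center v) x := by
    have := dist_triangle_right (F.center v + e) (F.center v) x
    rwa [dist_self_add_left, he] at this
  have h4 : F.radius m ≤ F.radius v := hm v (Finset.mem_univ v)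
  have h5 : 4 * (r₀ / 2 ^ k) < F.radius m := by
    rw [div_lt_iff₀ (F.radius_pos m)] at hk
    rw [← mul_div_assoc, div_lt_iff₀ (by positivity), mul_comm (F.radius m)]
    exact hk
  linarith

end FatFamily

/-! ### Graphs without edges and degree sums -/

theorem isBalancedSeparator_empty_of_forall_not_adj {V : Type*} [Fintype V] {G : SimpleGraph V}
    (hG : ∀ u v, ¬ G.Adj u v) (hn : Fintype.card V ≠ 1) : IsBalancedSeparator G ∅ := by
  intro c
  obtain ⟨u, hu⟩ := c.nonempty_supp
  have hsub : c.supp ⊆ {u} := by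
    intro v hv
    have hr := c.reachable_of_mem_supp hu hv
    rw [SimpleGraph.reachable_iff_reflTransGen] at hr
    rcases Relation.ReflTransGen.cases_head hr with h | ⟨w, hw, _⟩
    · exact h.symm
    · exact absurd hw (hG _ _)
  have h1 : c.supp.ncard ≤ 1 := by
    rw [← Set.ncard_singleton u]
    exact Set.ncard_le_ncard hsub
  have h2 : 2 ≤ Fintype.card V := by
    have : 0 < Fintype.card V := Fintype.card_pos_iff.2 ⟨u.1⟩
    omega
  have h3 : (c.supp.ncard : ℝ) ≤ 1 := by exact_mod_cast h1
  have h4 : (2 : ℝ) ≤ Fintype.card V := by exact_mod_cast h2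
  linarith

/-- The power mean inequality for the degrees of a graph. -/
theorem sum_degree_rpow_rpow_le {V : Type*} [Fintype V] (G : SimpleGraph V) [DecidableRel G.Adj]
    {d : ℕ} (hd : 2 ≤ d) (hV : 0 < Fintype.card V) :
    (∑ v, (G.degree v : ℝ) ^ (1 / ((d : ℝ) - 1))) ^ (1 - 1 / (d : ℝ)) ≤
      2 * ((G.edgeFinset.card : ℝ) ^ (1 / (d : ℝ)) *
        (Fintype.card V : ℝ) ^ (1 - 2 / (d : ℝ))) := by
  have hd2 : (2 : ℝ) ≤ d := by exact_mod_cast hd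
  have hd0 : (0 : ℝ) < d := by linarith
  have hd1 : (0 : ℝ) < (d : ℝ) - 1 := by linarith
  set q : ℝ := ∑ v, (G.degree v : ℝ) ^ (1 / ((d : ℝ) - 1)) with hq
  have hq0 : 0 ≤ q := Finset.sum_nonneg fun v _ => by positivity
  have hcard : (0 : ℝ) < Fintype.card V := by exact_mod_cast hV
  have h1 := Real.rpow_sum_le_const_mul_sum_rpow_of_nonneg Finset.univ
    (f := fun v => (G.degree v : ℝ) ^ (1 / ((d : ℝ) - 1))) (p := (d : ℝ) - 1) (by linarith)
    (fun v _ => by positivity)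
  have h2 : ∑ v, ((G.degree v : ℝ) ^ (1 / ((d : ℝ) - 1))) ^ ((d : ℝ) - 1)
      = 2 * (G.edgeFinset.card : ℝ) := by
    rw [Finset.sum_congr rfl fun v _ => show ((G.degree v : ℝ) ^ (1 / ((d : ℝ) - 1))) ^
      ((d : ℝ) - 1) = G.degree v by
        rw [← Real.rpow_mul (by positivity), one_div_mul_cancel hd1.ne', Real.rpow_one]]
    exact_mod_cast G.sum_degrees_eq_twice_card_edges
  rw [h2, Finset.card_univ, ← hq] at h1
  have h3 : q ^ (1 - 1 / (d : ℝ)) = (q ^ ((d : ℝ) - 1)) ^ (1 / (d : ℝ)) := by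
    rw [← Real.rpow_mul hq0]
    congr 1
    field_simp
  have h4 : ((Fintype.card V : ℝ) ^ ((d : ℝ) - 1 - 1)) ^ (1 / (d : ℝ))
      = (Fintype.card V : ℝ) ^ (1 - 2 / (d : ℝ)) := by
    rw [← Real.rpow_mul hcard.le]
    congr 1
    field_simp
    ring
  have h5 : (2 : ℝ) ^ (1 / (d : ℝ)) ≤ 2 := by
    calc (2 : ℝ) ^ (1 / (d : ℝ)) ≤ 2 ^ (1 : ℝ) := by
          apply Real.rpow_le_rpow_of_exponent_le one_le_two
          rw [div_le_one hd0]
          linarith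
      _ = 2 := Real.rpow_one 2
  rw [h3]
  refine (Real.rpow_le_rpow (by positivity) h1 (by positivity)).trans ?_
  rw [Real.mul_rpow (by positivity) (by positivity), h4,
    Real.mul_rpow (by positivity) (by positivity)]
  calc _ ≤ (Fintype.card V : ℝ) ^ (1 - 2 / (d : ℝ)) *
        (2 * (G.edgeFinset.card : ℝ) ^ (1 / (d : ℝ))) := by gcongr
    _ = _ := by ring

theorem IsFat.exists_concentric {d : ℕ} {C : ℝ} {B : Set (EuclideanSpace ℝ (Fin d))}
    (h : IsFat C B) : ∃ a R, 0 < R ∧ Metric.closedBall a R ⊆ B ∧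
      B ⊆ Metric.closedBall a (2 * max C 1 * R) := by
  obtain ⟨R, hR, ⟨a, ha⟩, b, hb⟩ := h
  refine ⟨a, R, hR, ha, fun p hp => ?_⟩
  have h1 : dist p b ≤ C * R := hb hp
  have h2 : dist a b ≤ C * R := hb (ha (Metric.mem_closedBall_self hR.le))
  have h3 : C * R ≤ max C 1 * R := mul_le_mul_of_nonneg_right (le_max_left _ _) hR.le
  rw [Metric.mem_closedBall]
  linarith [dist_triangle_right p a b]

theorem theorem4p3 (d : ℕ) (hd : 2 ≤ d) (C : ℝ) :
    ∃ A : ℝ, 0 < A ∧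
      ∀ (n : ℕ) (_ : n ≠ 1) (K : Fin n → ConvexBody (EuclideanSpace ℝ (Fin d)))
        (_ : ∀ i, IsFat C (K i : Set (EuclideanSpace ℝ (Fin d))))
        (S : Fin n → Set (EuclideanSpace ℝ (Fin d)))
        (_ : ∀ i, S i = frontier (K i : Set (EuclideanSpace ℝ (Fin d)))),
        (∃ X : Finset (Fin n), IsBalancedSeparator (intersectionGraph S) X ∧
          (X.card : ℝ) ≤ A *
            (∑ i, ((intersectionGraph S).degree i : ℝ) ^ (1 / ((d : ℝ) - 1))) ^
              (1 - 1 / (d : ℝ))) ∧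
        (∃ X : Finset (Fin n), IsBalancedSeparator (intersectionGraph S) X ∧
          (X.card : ℝ) ≤ A *
            ((intersectionGraph S).edgeFinset.card : ℝ) ^ (1 / (d : ℝ)) *
              (n : ℝ) ^ (1 - 2 / (d : ℝ))) := by
  have hD : 1 ≤ 2 * max C 1 := by linarith [le_max_right C 1]
  have hd2 : (2 : ℝ) ≤ d := by exact_mod_cast hd
  have hd1 : (0 : ℝ) < (d : ℝ) - 1 := by linarith
  obtain ⟨A, hA, hsep⟩ := FatFamily.exists_isBalancedSeparator d hd hD
  refine ⟨2 * A, by positivity, fun n hn K hK S hS => ?_⟩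
  obtain rfl : S = fun i => frontier (K i : Set (EuclideanSpace ℝ (Fin d))) := funext hS
  choose a R hR hin hout using fun i => (hK i).exists_concentric
  set F : FatFamily d (Fin n) (2 * max C 1) :=
    ⟨fun i => K i, a, R, fun i => (K i).convex, fun i => (K i).isCompact, hR, hin, hout⟩
  change (∃ X, IsBalancedSeparator F.graph X ∧ _ ≤ 2 * A *
    (∑ i, (F.graph.degree i : ℝ) ^ (1 / ((d : ℝ) - 1))) ^ (1 - 1 / (d : ℝ))) ∧
    ∃ X, IsBalancedSeparator F.graph X ∧ _ ≤ 2 * A * (F.graph.edgeFinset.card : ℝ) ^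
      (1 / (d : ℝ)) * (n : ℝ) ^ (1 - 2 / (d : ℝ))
  by_cases hG : ∀ u v, ¬ F.graph.Adj u v
  · have h0 := isBalancedSeparator_empty_of_forall_not_adj hG (by simpa using hn)
    exact ⟨⟨∅, h0, by rw [Finset.card_empty, Nat.cast_zero]; positivity⟩,
      ⟨∅, h0, by rw [Finset.card_empty, Nat.cast_zero]; positivity⟩⟩
  push Not at hG
  obtain ⟨u, v, huv⟩ := hG
  have hn2 : 2 ≤ Fintype.card (Fin n) := by
    have : 0 < Fintype.card (Fin n) := Fintype.card_pos_iff.2 ⟨u⟩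
    rw [Fintype.card_fin] at this ⊢
    omega
  set q : ℝ := ∑ i, (F.graph.degree i : ℝ) ^ (1 / ((d : ℝ) - 1)) with hq
  have hq1 : 1 ≤ q := by
    have h1 : (1 : ℝ) ≤ F.graph.degree u := by
      exact_mod_cast (SimpleGraph.degree_pos_iff_exists_adj _ _).2 ⟨v, huv⟩
    exact (Real.one_le_rpow h1 (by positivity)).trans
      (Finset.single_le_sum (f := fun i => (F.graph.degree i : ℝ) ^ (1 / ((d : ℝ) - 1)))
        (fun i _ => by positivity) (Finset.mem_univ u))
  have hq0 : 0 < q := by linarith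
  have hexp : 0 ≤ 1 - 1 / (d : ℝ) := by
    rw [sub_nonneg, div_le_one (by linarith)]
    linarith
  have hT1 : 1 ≤ q ^ (1 - 1 / (d : ℝ)) := Real.one_le_rpow hq1 hexp
  have hsum : ∑ i, ((F.graph.degree i : ℝ) / q ^ (1 - 1 / (d : ℝ))) ^ (1 / ((d : ℝ) - 1))
      ≤ q ^ (1 - 1 / (d : ℝ)) := by
    refine le_of_eq ?_
    rw [Finset.sum_congr rfl fun i _ => Real.div_rpow (by positivity) (by positivity) _,
      ← Finset.sum_div, ← hq, ← Real.rpow_mul hq0.le]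
    have h1 : (1 - 1 / (d : ℝ)) * (1 / ((d : ℝ) - 1)) = 1 / d := by field_simp
    rw [h1, Real.rpow_sub hq0, Real.rpow_one]
  obtain ⟨X, hX, hXcard⟩ := hsep (Fin n) F _ hn2 hT1 hsum
  refine ⟨⟨X, hX, hXcard.trans ?_⟩, ⟨X, hX, hXcard.trans ?_⟩⟩
  · have : 0 ≤ A * q ^ (1 - 1 / (d : ℝ)) := by positivity
    linarith
  · have h1 := sum_degree_rpow_rpow_le F.graph hd (by omega : 0 < Fintype.card (Fin n))
    rw [Fintype.card_fin, ← hq] at h1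
    calc A * q ^ (1 - 1 / (d : ℝ)) ≤ A * (2 * ((F.graph.edgeFinset.card : ℝ) ^ (1 / (d : ℝ)) *
          (n : ℝ) ^ (1 - 2 / (d : ℝ)))) := mul_le_mul_of_nonneg_left h1 hA.le
      _ = _ := by ring
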